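/- Let $\nu,\alpha>0$ and let $Z=(Z_s)_{s\ge 0}$ be a subordinator, i.e. a real-valued process with $Z_0=0$ almost surely, with independent and stationary increments and with almost surely nondecreasing, right-continuous paths. Assume that $Z$ has no drift and has L\'evy density $w(u)=\nu\alpha e^{-\alpha u}$, $u>0$; that is, $$E\big[e^{-zZ_1}\big]=\exp\Big(-\int_0^\infty (1-e^{-zu})\,w(u)\,du\Big)\qquad\text{for all } z\ge 0 .$$ For every $t>0$ let $T_t=\inf\{s>0: Z_s\ge t\}$ (with $\inf\emptyset=\infty$) be the first-exit time of $Z$ at level $t$. Then $T_t$ is almost surely finite and its law on $(0,\infty)$ has the probability density function $$h(x,t)=\nu e^{-x\nu}\,I_0\big(2\sqrt{x\nu\alpha t}\big)\,e^{-\alpha t},\qquad x>0,$$ with respect to Lebesgue measure in $x$, where $I_0(y)=\sum_{k\ge 0}\frac{(y/2)^{2k}}{(k!)^2}$ is the modified Bessel function of the first kind of order $0$. -/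

import Mathlib

open MeasureTheory ProbabilityTheory Set
open scoped NNReal ENNReal

namespace FirstExit

/-- A (Lévy) subordinator: a real-valued process started at `0` with independent and stationary
increments whose paths are almost surely nondecreasing and right-continuous (left limits then
exist automatically). -/
structure IsSubordinator {Ω : Type*} [MeasurableSpace Ω] (Z : ℝ≥0 → Ω → ℝ) (P : Measure Ω) :
    Prop where
  measurable : ∀ t, Measurable (Z t)
  start_zero : ∀ᵐ ω ∂P, Z 0 ω = 0
  indep_increments : HasIndepIncrements Z P
  stationary_increments : ∀ s h : ℝ≥0, IdentDistrib (fun ω => Z (s + h) ω - Z s ω) (Z h) P P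
  monotone_paths : ∀ᵐ ω ∂P, Monotone (fun t => Z t ω)
  right_continuous : ∀ᵐ ω ∂P, ∀ t : ℝ≥0, ContinuousWithinAt (fun s => Z s ω) (Ici t) t

/-- `π` is a Lévy measure of a subordinator: it lives on `(0, ∞)` and integrates `min 1 u`. -/
structure IsSubordinatorLevyMeasure (π : Measure ℝ) : Prop where
  concentrated : π (Iic 0) = 0
  integrates_min : ∫⁻ u, ENNReal.ofReal (min 1 u) ∂π < ∞

/-- The Laplace exponent `ψ(z) = ∫ (1 - e^{-zu}) π(du)` attached to a Lévy measure `π`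
(no drift and no killing). -/
noncomputable def laplaceExponent (π : Measure ℝ) (z : ℝ) : ℝ :=
  ∫ u, (1 - Real.exp (-(z * u))) ∂π

/-- The process `Z` has Lévy measure `π` and no drift: the law of `Z 1` has the
Lévy-Khinchin representation `E[e^{-z Z 1}] = e^{-ψ(z)}`, `z ≥ 0`, which determines `π`. -/
structure HasLevyMeasure {Ω : Type*} [MeasurableSpace Ω] (Z : ℝ≥0 → Ω → ℝ) (P : Measure Ω)
    (π : Measure ℝ) : Prop where
  isLevyMeasure : IsSubordinatorLevyMeasure π
  laplace : ∀ z : ℝ, 0 ≤ z →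
    ∫ ω, Real.exp (-(z * Z 1 ω)) ∂P = Real.exp (-laplaceExponent π z)

/-- The process `Z` has Lévy density `w` on `(0, ∞)` (and no drift). -/
structure HasLevyDensity {Ω : Type*} [MeasurableSpace Ω] (Z : ℝ≥0 → Ω → ℝ) (P : Measure Ω)
    (w : ℝ → ℝ) : Prop where
  measurable : Measurable w
  nonneg : ∀ u, 0 < u → 0 ≤ w u
  hasLevyMeasure :
    HasLevyMeasure Z P ((volume.restrict (Ioi 0)).withDensity fun u => ENNReal.ofReal (w u))

/-- The first-exit time `inf {s > 0 : Z s ≥ t}`, with `inf ∅ = ∞`. -/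
noncomputable def firstExitTime {Ω : Type*} (Z : ℝ≥0 → Ω → ℝ) (t : ℝ) (ω : Ω) : ℝ≥0∞ :=
  sInf ((fun s : ℝ≥0 => (s : ℝ≥0∞)) '' {s : ℝ≥0 | 0 < s ∧ t ≤ Z s ω})

/-- The `[0, ∞]`-valued random time `T` is almost surely finite and its law is absolutely
continuous on `(0, ∞)` with density `f`. -/
structure HasDensityOnPos {Ω : Type*} [MeasurableSpace Ω] (T : Ω → ℝ≥0∞) (P : Measure Ω)
    (f : ℝ → ℝ) : Prop where
  ae_finite : ∀ᵐ ω ∂P, T ω < ∞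
  measurable : Measurable f
  nonneg : ∀ x, 0 < x → 0 ≤ f x
  hasLaw : HasLaw (fun ω => (T ω).toReal)
    ((volume.restrict (Ioi 0)).withDensity fun x => ENNReal.ofReal (f x)) P

/-- The modified Bessel function of the first kind `I_n` of integer order `n ≥ 0`:
`I_n(x) = ∑ₖ (x/2)^(2k+n) / (k! (k+n)!)`. -/
noncomputable def besselI (n : ℕ) (x : ℝ) : ℝ :=
  ∑' k : ℕ, (x / 2) ^ (2 * k + n) / ((k.factorial : ℝ) * ((k + n).factorial : ℝ))

end FirstExit

/-!
A subordinator without drift whose Lévy density is `ν α e^{-αu}` is a compound Poisson process with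
jump rate `ν` and exponential jumps of rate `α`. Write `p_n(r) = e^{-r} r^n / n!`.

*Marginals.* By independence and stationarity of the increments, together with monotonicity of the
paths, `E[e^{-z Z_x}] = E[e^{-z Z_1}]^x` (`IsSubordinator.integral_exp_neg_eq`). This is the Laplace
transform of the law `∑_j p_j(νx) G_j` (`compoundPoissonExp`), where `G_j` is the law of a sum of `j`
exponential variables of rate `α` (`erlangMeasure`). A finite measure on `[0, ∞)` is determined by
its Laplace transform, even by its values at the natural numbers (`ext_of_integral_exp_neg_nat`), so
`Z_x` has that law.

*Exit time.* Almost every path is nondecreasing and right-continuous and starts at `0 < t`, hence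
`T_t ≤ x` if and only if `Z_x ≥ t` (`firstExitTime_le_iff`), and `P(T_t > x) = P(Z_x < t)`.

*Density.* The tail of an Erlang law is a Poisson sum:
`∫_x^∞ ν p_k(νy) dy = ∑_{j ≤ k} p_j(νx)` (`setLIntegral_Ioi_poissonWeight`). Used for the jumps, it
gives `G_j([0, t)) = ∑_{k ≥ j} p_k(αt)`, so that
`P(Z_x < t) = ∑_j p_j(νx) ∑_{k ≥ j} p_k(αt) = ∑_k p_k(αt) ∑_{j ≤ k} p_j(νx)`.
Used in the variable `x`, it shows that the last sum is the integral over `(x, ∞)` of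
`∑_k p_k(αt) ν p_k(νy)`, which is the claimed density by the power series of the Bessel function
`I_0` (`hasSum_poissonWeight_mul_poissonWeight`). Thus `T_t` and the claimed density have the same
tails. The tail at `0` is `P(Z_0 < t) = 1`, so the density has total mass `1`; since
`P(T_t = ∞) ≤ P(Z_n < t)` and the tails of a finite measure vanish, `T_t` is almost surely finite.
-/

namespace FirstExit

open Filter Topology

/-! ### Poisson weights and Erlang laws -/

/-- The mass `e^{-r} r^n / n!` that the Poisson law with parameter `r` gives to `n`. -/
noncomputable def poissonWeight (r : ℝ) (n : ℕ) : ℝ :=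
  Real.exp (-r) * r ^ n / (n.factorial : ℝ)

lemma poissonWeight_nonneg {r : ℝ} (hr : 0 ≤ r) (n : ℕ) : 0 ≤ poissonWeight r n := by
  unfold poissonWeight
  positivity

lemma continuous_poissonWeight (n : ℕ) : Continuous fun r => poissonWeight r n := by
  unfold poissonWeight
  fun_prop

lemma hasSum_poissonWeight_mul_pow (r q : ℝ) :
    HasSum (fun n => poissonWeight r n * q ^ n) (Real.exp (-(r * (1 - q)))) := by
  have h := (NormedSpace.expSeries_div_hasSum_exp (r * q)).mul_left (Real.exp (-r))
  rw [← Real.exp_eq_exp_ℝ, ← Real.exp_add] at h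
  convert! h using 2
  · unfold poissonWeight
    rw [mul_pow]
    ring
  · ring

lemma tsum_ofReal_poissonWeight {r : ℝ} (hr : 0 ≤ r) :
    ∑' n, ENNReal.ofReal (poissonWeight r n) = 1 := by
  have h := hasSum_poissonWeight_mul_pow r 1
  simp only [one_pow, mul_one, sub_self, mul_zero, neg_zero, Real.exp_zero] at h
  rw [← ENNReal.ofReal_tsum_of_nonneg (poissonWeight_nonneg hr) h.summable, h.tsum_eq,
    ENNReal.ofReal_one]

lemma hasDerivAt_sum_poissonWeight (k : ℕ) (r : ℝ) :
    HasDerivAt (fun r => ∑ j ∈ Finset.range (k + 1), poissonWeight r j) (-poissonWeight r k) r := by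
  induction k with
  | zero =>
    simp only [zero_add, Finset.sum_range_one, poissonWeight, pow_zero, mul_one,
      Nat.factorial_zero, Nat.cast_one, div_one]
    simpa using (hasDerivAt_neg r).exp
  | succ k ih =>
    simp_rw [Finset.sum_range_succ _ (k + 1)]
    have h : HasDerivAt (fun r => poissonWeight r (k + 1))
        (poissonWeight r k - poissonWeight r (k + 1)) r := by
      unfold poissonWeight
      have h1 := (((hasDerivAt_neg r).exp).mul (hasDerivAt_pow (k + 1) r)).div_const
        ((k + 1).factorial : ℝ)
      refine h1.congr_deriv ?_
      have : (k.factorial : ℝ) ≠ 0 := by positivity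
      rw [Nat.factorial_succ]
      push_cast
      field_simp
      ring
    exact (ih.add h).congr_deriv (by ring)

lemma tendsto_poissonWeight_atTop (n : ℕ) :
    Tendsto (fun r => poissonWeight r n) atTop (𝓝 0) := by
  have h := (Real.tendsto_pow_mul_exp_neg_atTop_nhds_zero n).div_const (n.factorial : ℝ)
  rw [zero_div] at h
  refine h.congr fun r => ?_
  unfold poissonWeight
  ring

/-- The tail of the Erlang law: the `(k + 1)`-st point of a Poisson process of rate `c` lies
beyond `x` exactly when at most `k` points fall in `[0, x]`. -/
lemma setLIntegral_Ioi_poissonWeight {c x : ℝ} (hc : 0 < c) (hx : 0 ≤ x) (k : ℕ) :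
    ∫⁻ y in Ioi x, ENNReal.ofReal (c * poissonWeight (c * y) k)
      = ∑ j ∈ Finset.range (k + 1), ENNReal.ofReal (poissonWeight (c * x) j) := by
  have hderiv : ∀ y ∈ Ioi x,
      HasDerivAt (fun y => -∑ j ∈ Finset.range (k + 1), poissonWeight (c * y) j)
        (c * poissonWeight (c * y) k) y := fun y _ => by
    have h := ((hasDerivAt_sum_poissonWeight k (c * y)).comp y
      ((hasDerivAt_id y).const_mul c)).neg
    exact h.congr_deriv (by ring)
  have hcont : ContinuousWithinAt
      (fun y => -∑ j ∈ Finset.range (k + 1), poissonWeight (c * y) j) (Ici x) x := by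
    refine Continuous.continuousWithinAt ?_
    refine (continuous_finsetSum _ fun j _ => ?_).neg
    exact (continuous_poissonWeight j).comp (continuous_const.mul continuous_id)
  have hpos : ∀ y ∈ Ioi x, 0 ≤ c * poissonWeight (c * y) k := fun y hy =>
    mul_nonneg hc.le (poissonWeight_nonneg (mul_nonneg hc.le (hx.trans (le_of_lt hy))) k)
  have hlim : Tendsto (fun y => -∑ j ∈ Finset.range (k + 1), poissonWeight (c * y) j)
      atTop (𝓝 0) := by
    have : Tendsto (fun y => ∑ j ∈ Finset.range (k + 1), poissonWeight (c * y) j)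
        atTop (𝓝 (∑ j ∈ Finset.range (k + 1), 0)) :=
      tendsto_finsetSum _ fun j _ =>
        (tendsto_poissonWeight_atTop j).comp (tendsto_id.const_mul_atTop hc)
    simpa using this.neg
  have hint := integrableOn_Ioi_deriv_of_nonneg hcont hderiv hpos hlim
  have hval := integral_Ioi_of_hasDerivAt_of_nonneg hcont hderiv hpos hlim
  rw [← ofReal_integral_eq_lintegral_ofReal hint
      ((ae_restrict_iff' measurableSet_Ioi).2 (ae_of_all _ hpos)), hval, zero_sub, neg_neg,
    ENNReal.ofReal_sum_of_nonneg fun j _ => poissonWeight_nonneg (mul_nonneg hc.le hx) j]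

lemma lintegral_Ioi_zero_poissonWeight {c : ℝ} (hc : 0 < c) (k : ℕ) :
    ∫⁻ y in Ioi 0, ENNReal.ofReal (c * poissonWeight (c * y) k) = 1 := by
  rw [setLIntegral_Ioi_poissonWeight hc le_rfl, Finset.sum_range_succ']
  simp [poissonWeight]

/-- The law of the sum of `n` independent exponential variables of rate `α`: the Dirac mass at `0`
for `n = 0`, the Erlang law with density `α e^{-αu} (αu)^{n-1} / (n-1)!` for `n ≥ 1`. -/
noncomputable def erlangMeasure (α : ℝ) : ℕ → Measure ℝ
  | 0 => Measure.dirac 0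
  | n + 1 => (volume.restrict (Ioi 0)).withDensity
      fun u => ENNReal.ofReal (α * poissonWeight (α * u) n)

lemma measurable_erlangDensity (α : ℝ) (n : ℕ) :
    Measurable fun u => ENNReal.ofReal (α * poissonWeight (α * u) n) :=
  (((continuous_poissonWeight n).measurable.comp (measurable_const_mul α)).const_mul
    α).ennreal_ofReal

lemma ae_nonneg_erlangMeasure (α : ℝ) (n : ℕ) : ∀ᵐ u ∂erlangMeasure α n, 0 ≤ u := by
  cases n with
  | zero =>
    rw [erlangMeasure, ae_dirac_eq]
    exact le_refl (0 : ℝ)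
  | succ n =>
    refine (withDensity_absolutelyContinuous _ _).ae_le ?_
    filter_upwards [ae_restrict_mem measurableSet_Ioi] with u hu using le_of_lt hu

lemma lintegral_exp_neg_erlangMeasure {α z : ℝ} (hα : 0 < α) (hz : 0 ≤ z) (n : ℕ) :
    ∫⁻ u, ENNReal.ofReal (Real.exp (-(z * u))) ∂erlangMeasure α n
      = ENNReal.ofReal ((α / (α + z)) ^ n) := by
  cases n with
  | zero =>
    rw [erlangMeasure, lintegral_dirac' _ (by fun_prop)]
    simp
  | succ n =>
    have hαz : 0 < α + z := by positivity
    rw [erlangMeasure, lintegral_withDensity_eq_lintegral_mul _ (measurable_erlangDensity α n)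
      (by fun_prop)]
    -- Tilting the Erlang density of rate `α` by `e^{-zu}` gives the one of rate `α + z`.
    have h : ∀ u ∈ Ioi (0 : ℝ), ((fun u => ENNReal.ofReal (α * poissonWeight (α * u) n)) *
        fun u => ENNReal.ofReal (Real.exp (-(z * u)))) u
        = ENNReal.ofReal ((α / (α + z)) ^ (n + 1)) *
          ENNReal.ofReal ((α + z) * poissonWeight ((α + z) * u) n) := fun u hu => by
      have hu' : (0 : ℝ) < u := hu
      have hp := poissonWeight_nonneg (mul_nonneg hα.le hu'.le) n
      rw [Pi.mul_apply, ← ENNReal.ofReal_mul (by positivity), ← ENNReal.ofReal_mul (by positivity)]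
      congr 1
      unfold poissonWeight
      have he : Real.exp (-((α + z) * u)) = Real.exp (-(α * u)) * Real.exp (-(z * u)) := by
        rw [← Real.exp_add]
        ring_nf
      rw [he, div_pow, mul_pow, mul_pow]
      field_simp
      ring
    rw [setLIntegral_congr_fun measurableSet_Ioi h,
      lintegral_const_mul _ (measurable_erlangDensity (α + z) n),
      lintegral_Ioi_zero_poissonWeight hαz, mul_one]

/-- The sum of `n` exponential variables of rate `α` stays below `t` exactly when a Poisson process
of rate `α` has at least `n` points in `[0, t]`. -/
lemma erlangMeasure_Iio {α t : ℝ} (hα : 0 < α) (ht : 0 < t) (n : ℕ) :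
    erlangMeasure α n (Iio t)
      = ∑' k, if n ≤ k then ENNReal.ofReal (poissonWeight (α * t) k) else 0 := by
  have hsum := tsum_ofReal_poissonWeight (mul_pos hα ht).le
  cases n with
  | zero =>
    rw [erlangMeasure, Measure.dirac_apply' _ measurableSet_Iio]
    simp [ht, hsum]
  | succ n =>
    rw [erlangMeasure, withDensity_apply _ measurableSet_Iio,
      Measure.restrict_restrict measurableSet_Iio, Iio_inter_Ioi]
    have htail := setLIntegral_Ioi_poissonWeight hα ht.le n
    have htot := lintegral_Ioi_zero_poissonWeight hα n
    rw [← Ioo_union_Ici_eq_Ioi ht, lintegral_union measurableSet_Ici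
      (by rw [Set.disjoint_left]; rintro a ⟨_, h⟩ h'; exact absurd h (not_lt.2 h')),
      setLIntegral_congr Ioi_ae_eq_Ici.symm, htail, ← hsum] at htot
    have hfin : ∑ j ∈ Finset.range (n + 1), ENNReal.ofReal (poissonWeight (α * t) j) ≠ ∞ :=
      ENNReal.sum_ne_top.2 fun _ _ => ENNReal.ofReal_ne_top
    refine (ENNReal.add_left_inj hfin).1 (htot.trans ?_)
    have hlow : ∑ j ∈ Finset.range (n + 1), ENNReal.ofReal (poissonWeight (α * t) j)
        = ∑' k, if n + 1 ≤ k then 0 else ENNReal.ofReal (poissonWeight (α * t) k) := by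
      rw [tsum_eq_sum (s := Finset.range (n + 1)) fun k hk => if_pos (by simpa using hk)]
      exact Finset.sum_congr rfl fun k hk => (if_neg (by simpa using hk)).symm
    rw [hlow, ← ENNReal.tsum_add]
    refine tsum_congr fun k => ?_
    split_ifs <;> simp

/-! ### The compound Poisson law with exponential jumps -/

/-- The law of a sum of `N` independent exponential variables of rate `α`, with `N` an independent
Poisson variable of parameter `r`. -/
noncomputable def compoundPoissonExp (r α : ℝ) : Measure ℝ :=
  Measure.sum fun n => ENNReal.ofReal (poissonWeight r n) • erlangMeasure α n

lemma ae_nonneg_compoundPoissonExp (r α : ℝ) : ∀ᵐ u ∂compoundPoissonExp r α, 0 ≤ u := by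
  rw [compoundPoissonExp, Measure.ae_sum_iff]
  exact fun n => Measure.ae_smul_measure (ae_nonneg_erlangMeasure α n) _

lemma lintegral_exp_neg_compoundPoissonExp {r α z : ℝ} (hr : 0 ≤ r) (hα : 0 < α) (hz : 0 ≤ z) :
    ∫⁻ u, ENNReal.ofReal (Real.exp (-(z * u))) ∂compoundPoissonExp r α
      = ENNReal.ofReal (Real.exp (-(r * (1 - α / (α + z))))) := by
  have h := hasSum_poissonWeight_mul_pow r (α / (α + z))
  simp_rw [compoundPoissonExp, lintegral_sum_measure, lintegral_smul_measure,
    lintegral_exp_neg_erlangMeasure hα hz, smul_eq_mul,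
    ← ENNReal.ofReal_mul (poissonWeight_nonneg hr _)]
  rw [← ENNReal.ofReal_tsum_of_nonneg
    (fun n => mul_nonneg (poissonWeight_nonneg hr n) (by positivity)) h.summable, h.tsum_eq]

lemma isProbabilityMeasure_compoundPoissonExp {r α : ℝ} (hr : 0 ≤ r) (hα : 0 < α) :
    IsProbabilityMeasure (compoundPoissonExp r α) :=
  ⟨by simpa [hα.ne'] using lintegral_exp_neg_compoundPoissonExp hr hα le_rfl⟩

lemma compoundPoissonExp_Iio {r α t : ℝ} (hα : 0 < α) (ht : 0 < t) :
    compoundPoissonExp r α (Iio t)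
      = ∑' k, ENNReal.ofReal (poissonWeight (α * t) k) *
          ∑ j ∈ Finset.range (k + 1), ENNReal.ofReal (poissonWeight r j) := by
  simp_rw [compoundPoissonExp, Measure.sum_apply _ measurableSet_Iio, Measure.smul_apply,
    erlangMeasure_Iio hα ht, smul_eq_mul, ← ENNReal.tsum_mul_left]
  rw [ENNReal.tsum_comm]
  refine tsum_congr fun k => ?_
  rw [tsum_eq_sum (s := Finset.range (k + 1)), Finset.mul_sum]
  · refine Finset.sum_congr rfl fun j hj => ?_
    rw [if_pos (Nat.lt_succ_iff.1 (Finset.mem_range.1 hj)), mul_comm]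
  · intro j hj
    rw [if_neg (fun h => hj (Finset.mem_range.2 (Nat.lt_succ_iff.2 h))), mul_zero]

/-! ### Uniqueness of Laplace transforms -/

/-- A bounded continuous injective function on the line which is `e^{-x}` on the half-line
`[0, ∞)`. The extension by `2 - e^x` on the negative half-line makes it strictly decreasing. -/
noncomputable def expNegExt : BoundedContinuousFunction ℝ ℝ :=
  BoundedContinuousFunction.ofNormedAddCommGroup
    (fun x => if 0 ≤ x then Real.exp (-x) else 2 - Real.exp x)
    (Continuous.if_le (by fun_prop) (by fun_prop) continuous_const continuous_id
      (by rintro x rfl; norm_num)) 2 (fun x => by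
        rw [Real.norm_eq_abs, abs_le]
        split_ifs with h
        · have h1 := Real.exp_pos (-x)
          have h2 : Real.exp (-x) ≤ 1 := Real.exp_le_one_iff.2 (by linarith)
          constructor <;> linarith
        · have h1 := Real.exp_pos x
          have h2 : Real.exp x ≤ 1 := Real.exp_le_one_iff.2 (by linarith)
          constructor <;> linarith)

lemma expNegExt_of_nonneg {x : ℝ} (hx : 0 ≤ x) : expNegExt x = Real.exp (-x) := if_pos hx

lemma expNegExt_of_neg {x : ℝ} (hx : x < 0) : expNegExt x = 2 - Real.exp x := if_neg hx.not_ge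

lemma expNegExt_injective : Function.Injective expNegExt := by
  refine StrictAnti.injective fun x y hxy => ?_
  rcases le_or_gt 0 x with hx | hx
  · rw [expNegExt_of_nonneg hx, expNegExt_of_nonneg (hx.trans hxy.le)]
    exact Real.exp_lt_exp.2 (by linarith)
  · have h1 : Real.exp x < 1 := Real.exp_lt_one_iff.2 hx
    rw [expNegExt_of_neg hx]
    rcases le_or_gt 0 y with hy | hy
    · have h2 : Real.exp (-y) ≤ 1 := Real.exp_le_one_iff.2 (by linarith)
      rw [expNegExt_of_nonneg hy]
      linarith
    · rw [expNegExt_of_neg hy]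
      have := Real.exp_lt_exp.2 hxy
      linarith

/-- Two finite measures on `[0, ∞)` whose Laplace transforms agree at the natural numbers are
equal: the polynomials in `e^{-x}` form an algebra separating points. -/
theorem ext_of_integral_exp_neg_nat {μ μ' : Measure ℝ} [IsFiniteMeasure μ] [IsFiniteMeasure μ']
    (hμ : ∀ᵐ x ∂μ, 0 ≤ x) (hμ' : ∀ᵐ x ∂μ', 0 ≤ x)
    (h : ∀ n : ℕ, ∫ x, Real.exp (-(n * x)) ∂μ = ∫ x, Real.exp (-(n * x)) ∂μ') : μ = μ' := by
  let A : StarSubalgebra ℝ (BoundedContinuousFunction ℝ ℝ) :=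
    { Algebra.adjoin ℝ {expNegExt} with
      star_mem' := fun {a} ha => by
        have : star a = a := by ext x; simp
        rw [this]; exact ha }
  refine ext_of_forall_mem_subalgebra_integral_eq_of_polish (𝕜 := ℝ) (A := A) ?_ ?_
  · intro x y hxy
    refine ⟨expNegExt, ⟨expNegExt.toContinuousMap, ⟨expNegExt, ?_, rfl⟩, rfl⟩,
      fun he => hxy (expNegExt_injective he)⟩
    exact Algebra.subset_adjoin (mem_singleton _)
  · have hpow : ∀ (ρ : Measure ℝ), (∀ᵐ x ∂ρ, 0 ≤ x) → ∀ n : ℕ,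
        ∫ x, (expNegExt ^ n) x ∂ρ = ∫ x, Real.exp (-(n * x)) ∂ρ := fun ρ hρ n => by
      refine integral_congr_ae ?_
      filter_upwards [hρ] with x hx
      rw [BoundedContinuousFunction.pow_apply, expNegExt_of_nonneg hx, ← Real.exp_nat_mul]
      ring_nf
    intro g hg
    have hg' : g ∈ Algebra.adjoin ℝ {expNegExt} := hg
    rw [Algebra.adjoin_singleton_eq_range_aeval] at hg'
    obtain ⟨p, rfl⟩ := hg'
    change ∫ x, (Polynomial.aeval expNegExt p) x ∂μ = ∫ x, (Polynomial.aeval expNegExt p) x ∂μ'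
    induction p using Polynomial.induction_on' with
    | add p q hp hq =>
      simp only [map_add, BoundedContinuousFunction.coe_add, Pi.add_apply]
      rw [integral_add (BoundedContinuousFunction.integrable _ _)
          (BoundedContinuousFunction.integrable _ _),
        integral_add (BoundedContinuousFunction.integrable _ _)
          (BoundedContinuousFunction.integrable _ _), hp, hq]
      all_goals exact (Algebra.adjoin_singleton_eq_range_aeval ℝ expNegExt).ge ⟨_, rfl⟩
    | monomial n a =>
      simp only [Polynomial.aeval_monomial, ← Algebra.smul_def,
        BoundedContinuousFunction.coe_smul]
      rw [integral_smul, integral_smul, hpow μ hμ, hpow μ' hμ', h]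

/-! ### One-dimensional marginals of the subordinator -/

/-- Cauchy's functional equation on the half-line: monotone additive functions are linear. -/
lemma eq_mul_of_monotone_of_map_add {g : ℝ≥0 → ℝ} (hmono : Monotone g)
    (hadd : ∀ a b, g (a + b) = g a + g b) (s : ℝ≥0) : g s = s * g 1 := by
  have hnsmul : ∀ (n : ℕ) (a : ℝ≥0), g (n * a) = n * g a := fun n a => by
    induction n with
    | zero =>
      have := hadd 0 0
      simp only [add_zero] at this
      simp only [Nat.cast_zero, zero_mul]
      linarith
    | succ n ih =>
      push_cast
      rw [add_mul, one_mul, hadd, ih]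
      ring
  have hnat : ∀ m : ℕ, g m = m * g 1 := fun m => by simpa using hnsmul m 1
  have hg0 : g 0 = 0 := by simpa using hnsmul 0 0
  have hg1 : 0 ≤ g 1 := hg0 ▸ hmono zero_le_one
  -- With `m = ⌊n s⌋`, both `n g(s)` and `n s g(1)` lie between `m g(1)` and `(m + 1) g(1)`.
  have hbound : ∀ n : ℕ, n * |g s - s * g 1| ≤ g 1 := fun n => by
    have h1 : ((⌊(n : ℝ≥0) * s⌋₊ : ℕ) : ℝ≥0) ≤ n * s := Nat.floor_le zero_le
    have h2 : (n : ℝ≥0) * s ≤ ((⌊(n : ℝ≥0) * s⌋₊ + 1 : ℕ) : ℝ≥0) := by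
      push_cast
      exact (Nat.lt_floor_add_one _).le
    have e1 := hmono h1
    have e2 := hmono h2
    rw [hnat, hnsmul] at e1 e2
    have r1 : ((⌊(n : ℝ≥0) * s⌋₊ : ℕ) : ℝ) ≤ n * s := by exact_mod_cast h1
    have r2 : (n : ℝ) * s ≤ ((⌊(n : ℝ≥0) * s⌋₊ + 1 : ℕ) : ℝ) := by exact_mod_cast h2
    have f1 := mul_le_mul_of_nonneg_right r1 hg1
    have f2 := mul_le_mul_of_nonneg_right r2 hg1
    push_cast at e2 f2
    have : (n : ℝ) * |g s - s * g 1| = |n * g s - n * s * g 1| := by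
      rw [mul_assoc, ← mul_sub, abs_mul, Nat.abs_cast]
    rw [this, abs_le]
    constructor <;> linarith
  by_contra hne
  have hpos : 0 < |g s - s * g 1| := abs_pos.2 (sub_ne_zero.2 hne)
  obtain ⟨n, hn⟩ := exists_nat_gt (g 1 / |g s - s * g 1|)
  rw [div_lt_iff₀ hpos] at hn
  exact absurd (hbound n) (not_le.2 hn)

section Subordinator

variable {Ω : Type*} [MeasurableSpace Ω] {P : Measure Ω} {Z : ℝ≥0 → Ω → ℝ}

lemma IsSubordinator.ae_nonneg (hZ : IsSubordinator Z P) (s : ℝ≥0) : ∀ᵐ ω ∂P, 0 ≤ Z s ω := by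
  filter_upwards [hZ.start_zero, hZ.monotone_paths] with ω h0 hm
  exact h0 ▸ hm (zero_le (a := s))

lemma IsSubordinator.integrable_exp_neg [IsFiniteMeasure P] (hZ : IsSubordinator Z P)
    {z : ℝ} (hz : 0 ≤ z) (s : ℝ≥0) : Integrable (fun ω => Real.exp (-(z * Z s ω))) P := by
  refine Integrable.of_bound (C := 1) ?_ ?_
  · exact ((hZ.measurable s).const_mul z).neg.exp.aestronglyMeasurable
  · filter_upwards [hZ.ae_nonneg s] with ω h
    rw [Real.norm_eq_abs, Real.abs_exp]
    exact Real.exp_le_one_iff.2 (by nlinarith)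

lemma IsSubordinator.integral_exp_neg_add (hZ : IsSubordinator Z P) (z : ℝ) (s h : ℝ≥0) :
    ∫ ω, Real.exp (-(z * Z (s + h) ω)) ∂P
      = (∫ ω, Real.exp (-(z * Z s ω)) ∂P) * ∫ ω, Real.exp (-(z * Z h ω)) ∂P := by
  have hφ : Measurable fun x : ℝ => Real.exp (-(z * x)) := by fun_prop
  have hind := (hZ.indep_increments.indepFun_eval_sub (zero_le (a := s))
    (le_self_add : s ≤ s + h) hZ.start_zero).comp hφ hφ
  have hmul := hind.integral_mul_eq_mul_integral
    (hφ.comp (hZ.measurable s)).aestronglyMeasurable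
    (hφ.comp ((hZ.measurable (s + h)).sub (hZ.measurable s))).aestronglyMeasurable
  have hstat := ((hZ.stationary_increments s h).comp hφ).integral_eq
  simp only [Function.comp_def, Pi.mul_apply, Pi.sub_apply] at hmul hstat
  rw [← hstat, ← hmul]
  refine integral_congr_ae (ae_of_all _ fun ω => ?_)
  simp only [← Real.exp_add]
  ring_nf

/-- The Laplace transform of `Z s` is the `s`-th power of that of `Z 1`. -/
lemma IsSubordinator.integral_exp_neg_eq [IsProbabilityMeasure P] (hZ : IsSubordinator Z P)
    {z a : ℝ} (hz : 0 ≤ z) (h1 : ∫ ω, Real.exp (-(z * Z 1 ω)) ∂P = Real.exp (-a)) (s : ℝ≥0) :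
    ∫ ω, Real.exp (-(z * Z s ω)) ∂P = Real.exp (-(s * a)) := by
  have hpos : ∀ s, 0 < ∫ ω, Real.exp (-(z * Z s ω)) ∂P := fun s =>
    integral_exp_pos (hZ.integrable_exp_neg hz s)
  have h := eq_mul_of_monotone_of_map_add
    (g := fun s => -Real.log (∫ ω, Real.exp (-(z * Z s ω)) ∂P)) ?_ ?_ s
  · simp only [h1, Real.log_exp, neg_neg] at h
    rw [← h, neg_neg, Real.exp_log (hpos s)]
  · intro s u hsu
    refine neg_le_neg (Real.log_le_log (hpos u) ?_)
    refine integral_mono_ae (hZ.integrable_exp_neg hz u) (hZ.integrable_exp_neg hz s) ?_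
    filter_upwards [hZ.monotone_paths] with ω hm
    exact Real.exp_le_exp.2 (neg_le_neg (mul_le_mul_of_nonneg_left (hm hsu) hz))
  · intro s u
    simp only [hZ.integral_exp_neg_add, Real.log_mul (hpos s).ne' (hpos u).ne']
    ring

lemma integral_exp_neg_eq_of_lintegral {μ : Measure ℝ} {z c : ℝ} (hc : 0 ≤ c)
    (h : ∫⁻ u, ENNReal.ofReal (Real.exp (-(z * u))) ∂μ = ENNReal.ofReal c) :
    ∫ u, Real.exp (-(z * u)) ∂μ = c := by
  rw [integral_eq_lintegral_of_nonneg_ae (ae_of_all _ fun _ => (Real.exp_pos _).le)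
    (by fun_prop), h, ENNReal.toReal_ofReal hc]

/-- The Laplace exponent of the Lévy density `ν α e^{-αu}`, which is `ν` times the exponential law
of rate `α`. -/
lemma laplaceExponent_exp {ν α z : ℝ} (hν : 0 < ν) (hα : 0 < α) (hz : 0 ≤ z) :
    laplaceExponent ((volume.restrict (Ioi 0)).withDensity
      fun u => ENNReal.ofReal (ν * α * Real.exp (-(α * u)))) z = ν * (1 - α / (α + z)) := by
  have hm : (volume.restrict (Ioi 0)).withDensity
      (fun u => ENNReal.ofReal (ν * α * Real.exp (-(α * u))))
      = ENNReal.ofReal ν • erlangMeasure α 1 := by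
    rw [erlangMeasure, ← withDensity_smul _ (measurable_erlangDensity α 0)]
    congr 1
    ext u
    simp [poissonWeight, ENNReal.ofReal_mul hν.le, mul_assoc]
  have hL := fun z hz => lintegral_exp_neg_erlangMeasure (z := z) hα hz 1
  simp only [pow_one] at hL
  have hprob : IsProbabilityMeasure (erlangMeasure α 1) :=
    ⟨by simpa [hα.ne'] using hL 0 le_rfl⟩
  have hαz : 0 < α + z := by positivity
  have hint : Integrable (fun u => Real.exp (-(z * u))) (erlangMeasure α 1) := by
    refine ⟨by fun_prop, ?_⟩
    rw [hasFiniteIntegral_iff_ofReal (ae_of_all _ fun _ => (Real.exp_pos _).le), hL z hz]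
    exact ENNReal.ofReal_lt_top
  rw [laplaceExponent, hm, integral_smul_measure, integral_sub (integrable_const _) hint,
    integral_exp_neg_eq_of_lintegral (by positivity) (hL z hz)]
  simp [ENNReal.toReal_ofReal hν.le]

/-- A subordinator without drift and with Lévy density `ν α e^{-αu}` has compound Poisson marginals:
both laws live on `[0, ∞)` and have the same Laplace transform. -/
theorem IsSubordinator.map_eq_compoundPoissonExp [IsProbabilityMeasure P]
    (hZ : IsSubordinator Z P) {ν α : ℝ} (hν : 0 < ν) (hα : 0 < α)
    (hw : HasLevyDensity Z P (fun u => ν * α * Real.exp (-(α * u)))) (s : ℝ≥0) :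
    P.map (Z s) = compoundPoissonExp (ν * s) α := by
  have hr : 0 ≤ ν * s := by positivity
  have := isProbabilityMeasure_compoundPoissonExp hr hα
  have := Measure.isProbabilityMeasure_map (μ := P) (hZ.measurable s).aemeasurable
  refine ext_of_integral_exp_neg_nat ?_ (ae_nonneg_compoundPoissonExp _ _) fun n => ?_
  · rw [ae_map_iff (hZ.measurable s).aemeasurable measurableSet_Ici]
    exact hZ.ae_nonneg s
  · have hn : (0 : ℝ) ≤ n := n.cast_nonneg
    have h1 := hw.hasLevyMeasure.laplace n hn
    rw [laplaceExponent_exp hν hα hn] at h1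
    rw [integral_map (hZ.measurable s).aemeasurable (by fun_prop),
      hZ.integral_exp_neg_eq hn h1 s, integral_exp_neg_eq_of_lintegral (Real.exp_pos _).le
        (lintegral_exp_neg_compoundPoissonExp hr hα hn)]
    ring_nf

end Subordinator

/-! ### The Bessel density -/

lemma hasSum_besselI_zero (x : ℝ) :
    HasSum (fun k : ℕ => (x / 2) ^ (2 * k) / ((k.factorial : ℝ) * (k.factorial : ℝ)))
      (besselI 0 x) := by
  refine Summable.hasSum (f := fun k : ℕ =>
    (x / 2) ^ (2 * k + 0) / ((k.factorial : ℝ) * ((k + 0).factorial : ℝ))) ?_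
  simp only [add_zero]
  refine Summable.of_nonneg_of_le (fun k => ?_) (fun k => ?_)
    (Real.summable_pow_div_factorial ((x / 2) ^ 2))
  · rw [pow_mul]
    positivity
  · rw [pow_mul, ← div_div]
    refine div_le_self (by positivity) ?_
    exact_mod_cast Nat.succ_le_of_lt k.factorial_pos

lemma measurable_besselI_zero : Measurable (besselI 0) := by
  refine measurable_of_tendsto_metrizable (f := fun n x => ∑ k ∈ Finset.range n,
    (x / 2) ^ (2 * k) / ((k.factorial : ℝ) * (k.factorial : ℝ))) (fun n => ?_)
    (tendsto_pi_nhds.2 fun x => (hasSum_besselI_zero x).tendsto_sum_nat)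
  fun_prop

/-- The density of the first-exit time, seen as a mixture of Erlang densities of rate `ν` with
Poisson weights of parameter `αt`. -/
lemma hasSum_poissonWeight_mul_poissonWeight {ν α t y : ℝ} (hν : 0 ≤ ν) (hα : 0 ≤ α) (ht : 0 ≤ t)
    (hy : 0 ≤ y) :
    HasSum (fun k => poissonWeight (α * t) k * (ν * poissonWeight (ν * y) k))
      (ν * Real.exp (-(y * ν)) * besselI 0 (2 * Real.sqrt (y * ν * α * t))
        * Real.exp (-(α * t))) := by
  have h := ((hasSum_besselI_zero (2 * Real.sqrt (y * ν * α * t))).mul_left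
    (ν * Real.exp (-(y * ν)))).mul_right (Real.exp (-(α * t)))
  convert! h using 2 with k
  rw [mul_div_cancel_left₀ _ (two_ne_zero' ℝ), pow_mul, Real.sq_sqrt (by positivity)]
  unfold poissonWeight
  rw [mul_comm y ν, mul_pow, mul_pow, mul_pow, mul_pow, mul_pow]
  ring

lemma setLIntegral_Ioi_besselDensity {ν α t x : ℝ} (hν : 0 < ν) (hα : 0 < α) (ht : 0 < t)
    (hx : 0 ≤ x) :
    ∫⁻ y in Ioi x, ENNReal.ofReal (ν * Real.exp (-(y * ν))
        * besselI 0 (2 * Real.sqrt (y * ν * α * t)) * Real.exp (-(α * t)))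
      = compoundPoissonExp (ν * x) α (Iio t) := by
  have hαt : 0 ≤ α * t := by positivity
  have h : ∀ y ∈ Ioi x, ENNReal.ofReal (ν * Real.exp (-(y * ν))
        * besselI 0 (2 * Real.sqrt (y * ν * α * t)) * Real.exp (-(α * t)))
      = ∑' k, ENNReal.ofReal (poissonWeight (α * t) k) *
          ENNReal.ofReal (ν * poissonWeight (ν * y) k) := fun y hy => by
    have hy0 : 0 ≤ y := hx.trans (le_of_lt hy)
    have hs := hasSum_poissonWeight_mul_poissonWeight hν.le hα.le ht.le hy0
    have h1 := poissonWeight_nonneg hαt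
    have h2 := poissonWeight_nonneg (mul_nonneg hν.le hy0)
    rw [← hs.tsum_eq, ENNReal.ofReal_tsum_of_nonneg
      (fun k => mul_nonneg (h1 k) (mul_nonneg hν.le (h2 k))) hs.summable]
    exact tsum_congr fun k => ENNReal.ofReal_mul (h1 k)
  rw [setLIntegral_congr_fun measurableSet_Ioi h, lintegral_tsum fun k =>
    ((measurable_erlangDensity ν k).const_mul _).aemeasurable, compoundPoissonExp_Iio hα ht]
  refine tsum_congr fun k => ?_
  rw [lintegral_const_mul _ (measurable_erlangDensity ν k), setLIntegral_Ioi_poissonWeight hν hx]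

/-! ### The first-exit time -/

/-- For a nondecreasing right-continuous path starting below `t`, the first-exit time is the
generalized inverse of the path. -/
lemma firstExitTime_le_iff {Ω : Type*} {Z : ℝ≥0 → Ω → ℝ} {t : ℝ} {ω : Ω}
    (hmono : Monotone fun s => Z s ω)
    (hright : ∀ s : ℝ≥0, ContinuousWithinAt (fun s => Z s ω) (Ici s) s) (h0 : Z 0 ω < t)
    (x : ℝ≥0) : firstExitTime Z t ω ≤ x ↔ t ≤ Z x ω := by
  constructor
  · intro h
    refine ge_of_tendsto ((hright x).mono_left (nhdsWithin_mono x Ioi_subset_Ici_self)) ?_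
    filter_upwards [self_mem_nhdsWithin] with s hs
    have hlt : firstExitTime Z t ω < s := h.trans_lt (ENNReal.coe_lt_coe.2 hs)
    obtain ⟨_, ⟨r, ⟨_, hr⟩, rfl⟩, hrs⟩ := sInf_lt_iff.1 hlt
    exact hr.trans (hmono (ENNReal.coe_lt_coe.1 hrs).le)
  · intro h
    refine sInf_le ⟨x, ⟨pos_iff_ne_zero.2 ?_, h⟩, rfl⟩
    rintro rfl
    exact absurd h (not_le.2 h0)

end FirstExit

theorem mainTheorem3 {Ω : Type*} [MeasurableSpace Ω] (P : Measure Ω) [IsProbabilityMeasure P]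
    (Z : ℝ≥0 → Ω → ℝ) (ν α : ℝ) (hν : 0 < ν) (hα : 0 < α)
    (hZ : FirstExit.IsSubordinator Z P)
    (hw : FirstExit.HasLevyDensity Z P (fun u => ν * α * Real.exp (-(α * u))))
    (t : ℝ) (ht : 0 < t) :
    FirstExit.HasDensityOnPos (FirstExit.firstExitTime Z t) P
      (fun x => ν * Real.exp (-(x * ν)) * FirstExit.besselI 0 (2 * Real.sqrt (x * ν * α * t))
        * Real.exp (-(α * t))) := by
  set f : ℝ → ℝ := fun x => ν * Real.exp (-(x * ν)) *
    FirstExit.besselI 0 (2 * Real.sqrt (x * ν * α * t)) * Real.exp (-(α * t))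
  set μ : Measure ℝ := (volume.restrict (Ioi 0)).withDensity fun x => ENNReal.ofReal (f x) with hμ
  have hfm : Measurable f := by
    have := FirstExit.measurable_besselI_zero.comp
      (f := fun x => 2 * Real.sqrt (x * ν * α * t)) (by fun_prop)
    exact (Measurable.mul (by fun_prop) this).mul_const _
  have htail : ∀ x : ℝ≥0, μ (Ioi x) = P {ω | Z x ω < t} := fun x => by
    rw [hμ, withDensity_apply _ measurableSet_Ioi, Measure.restrict_restrict measurableSet_Ioi,
      Ioi_inter_Ioi, max_eq_left x.coe_nonneg,
      FirstExit.setLIntegral_Ioi_besselDensity hν hα ht x.coe_nonneg,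
      ← hZ.map_eq_compoundPoissonExp hν hα hw x, Measure.map_apply (hZ.measurable x)
        measurableSet_Iio]
    rfl
  have hneg : μ (Iic 0) = 0 := by
    rw [hμ, withDensity_apply _ measurableSet_Iic, Measure.restrict_restrict measurableSet_Iic,
      Iic_inter_Ioi, Ioc_self]
    simp
  have hprob : IsProbabilityMeasure μ := ⟨by
    have h0 : P {ω | Z 0 ω < t} = 1 := by
      rw [← measure_univ (μ := P)]
      refine measure_congr (Filter.eventuallyEq_univ.2 ?_)
      filter_upwards [hZ.start_zero] with ω h0
      exact h0.trans_lt ht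
    rw [← Iic_union_Ioi (a := (0 : ℝ)), measure_union (Iic_disjoint_Ioi le_rfl) measurableSet_Ioi,
      hneg, zero_add]
    simpa [h0] using htail 0⟩
  have hle : ∀ᵐ ω ∂P, ∀ x : ℝ≥0, FirstExit.firstExitTime Z t ω ≤ x ↔ t ≤ Z x ω := by
    filter_upwards [hZ.monotone_paths, hZ.right_continuous, hZ.start_zero] with ω hm hr h0
    exact FirstExit.firstExitTime_le_iff hm hr (h0 ▸ ht)
  have hfin : ∀ᵐ ω ∂P, FirstExit.firstExitTime Z t ω < ∞ := by
    -- `P (T = ∞) ≤ P (Z n < t) = μ (n, ∞)` for every `n`, and `μ` is finite.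
    have hbound : ∀ n : ℕ, P {ω | ¬ FirstExit.firstExitTime Z t ω < ∞} ≤ μ (Ioi (n : ℝ)) :=
      fun n => by
        have h := htail n
        rw [NNReal.coe_natCast] at h
        rw [h]
        refine measure_mono_ae ?_
        filter_upwards [hle] with ω hω hT
        by_contra hge
        exact hT (((hω n).2 (not_lt.1 hge)).trans_lt ENNReal.coe_lt_top)
    have hlim : Filter.Tendsto (fun n : ℕ => μ (Ioi (n : ℝ))) Filter.atTop (nhds 0) := by
      have h := tendsto_measure_iInter_atTop (μ := μ) (s := fun n : ℕ => Ioi (n : ℝ))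
        (fun n => nullMeasurableSet_Ioi)
        (fun m n hmn => Ioi_subset_Ioi (Nat.cast_le.2 hmn)) ⟨0, measure_ne_top _ _⟩
      have he : ⋂ n : ℕ, Ioi (n : ℝ) = ∅ := by
        refine eq_empty_of_forall_notMem fun y hy => ?_
        obtain ⟨n, hn⟩ := exists_nat_gt y
        exact absurd (mem_iInter.1 hy n) (not_lt.2 hn.le)
      rwa [he, measure_empty] at h
    exact le_antisymm (ge_of_tendsto' hlim hbound) zero_le
  have hset : ∀ x : ℝ≥0, {ω | (FirstExit.firstExitTime Z t ω).toReal ≤ x} =ᵐ[P]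
      {ω | t ≤ Z x ω} := fun x => by
    filter_upwards [hle, hfin] with ω hω hT
    refine propext ?_
    change (FirstExit.firstExitTime Z t ω).toReal ≤ x ↔ t ≤ Z x ω
    rw [← hω x, ← ENNReal.coe_toReal, ENNReal.toReal_le_toReal hT.ne ENNReal.coe_ne_top]
  have hempty : ∀ x < (0 : ℝ), {ω | (FirstExit.firstExitTime Z t ω).toReal ≤ x} = ∅ :=
    fun x hx => eq_empty_of_forall_notMem fun ω hω =>
      absurd (ENNReal.toReal_nonneg.trans hω) (not_le.2 hx)
  have hmeas : ∀ x : ℝ≥0, MeasurableSet {ω | t ≤ Z x ω} := fun x =>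
    measurableSet_le measurable_const (hZ.measurable x)
  have hae : AEMeasurable (fun ω => (FirstExit.firstExitTime Z t ω).toReal) P := by
    refine NullMeasurable.aemeasurable ?_
    refine measurable_of_Iic (δ := NullMeasurableSpace Ω P) fun x => ?_
    change NullMeasurableSet {ω | (FirstExit.firstExitTime Z t ω).toReal ≤ x} P
    rcases lt_or_ge x 0 with hx | hx
    · rw [hempty x hx]
      exact nullMeasurableSet_empty
    · lift x to ℝ≥0 using hx
      exact (hmeas x).nullMeasurableSet.congr (hset x).symm
  refine ⟨hfin, hfm, fun x hx => ?_, hae, ?_⟩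
  · have h := FirstExit.hasSum_poissonWeight_mul_poissonWeight hν.le hα.le ht.le hx.le
    exact h.nonneg fun k => mul_nonneg (FirstExit.poissonWeight_nonneg (by positivity) k)
      (mul_nonneg hν.le (FirstExit.poissonWeight_nonneg (by positivity) k))
  · refine Measure.ext_of_Iic _ _ fun x => ?_
    rw [Measure.map_apply_of_aemeasurable hae measurableSet_Iic]
    change P {ω | (FirstExit.firstExitTime Z t ω).toReal ≤ x} = _
    rcases lt_or_ge x 0 with hx | hx
    · rw [hempty x hx, measure_empty, measure_mono_null (Iic_subset_Iic.2 hx.le) hneg]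
    · lift x to ℝ≥0 using hx
      rw [measure_congr (hset x), ← compl_Ioi, prob_compl_eq_one_sub measurableSet_Ioi, htail x,
        ← prob_compl_eq_one_sub (measurableSet_lt (hZ.measurable x) measurable_const)]
      congr 1
      ext ω
      simp
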